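/- Let $n\ge 2$ and let $(M,F)$ be a connected smooth $n$-dimensional Finsler manifold: $F:TM\to[0,\infty)$ is $C^\infty$ on the slit tangent bundle, satisfies $F(x,\lambda y)=\lambda F(x,y)$ for $\lambda>0$, and $g_{ij}=[\tfrac12F^2]_{y^iy^j}$ is positive definite for $y\neq0$. Let $G^i=\tfrac12 g^{il}\{[F^2]_{x^ky^l}y^k-[F^2]_{x^l}\}$, so that unit-speed geodesics satisfy $\ddot x^i+G^i(x,\dot x)=0$; let $$R^i{}_k=\tfrac12\Big\{2(G^i)_{x^k}-\tfrac12(G^i)_{y^j}(G^j)_{y^k}-y^j(G^i)_{y^kx^j}+G^j(G^i)_{y^ky^j}\Big\}$$ be the Riemann curvature, and $Ric_{jk}=\tfrac12\,[R^i{}_i]_{y^jy^k}$ the Ricci tensor. Assume that for some constant $c>0$ $$Ric_{ij}\le -c^2g_{ij}\quad\text{as matrices, at all }y\ne0 .$$ Let $d_F(x_0,x_1)$ be the infimum of the lengths $\int F(\gamma,\dot\gamma)\,dt$ of piecewise $C^\infty$ curves $\gamma$ from $x_0$ to $x_1$, and let $\rho(a,b)=\left|\ln\frac{(1-a)(1+b)}{(1-b)(1+a)}\right|$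 be the Poincaré distance on $I=(-1,1)$. Let $f:I\to M$ be a projective map, that is, there are a unit-speed geodesic $x:J\to M$ on an open interval $J$ and a $C^\infty$ function $p:J\to\mathbb R$ with $p'\neq0$, $p(J)=I$, $f(p(s))=x(s)$ and $$\frac{p'''}{p'}-\frac32\Big(\frac{p''}{p'}\Big)^2=\frac{2}{n-1}\,Ric_{jk}(x,\dot x)\,\dot x^j\dot x^k\quad\text{on }J .$$ Then $$\rho(a,b)\ \ge\ \frac{2c}{\sqrt{n-1}}\;d_F\big(f(a),f(b)\big)$$ for all $a=p(s_1)$, $b=p(s_2)$ with $s_1\le s_2$ in $J$ (that is, whenever $f$ runs from $f(a)$ to $f(b)$ in the direction of the geodesic; if $p$ is increasing, for all $a\le b$ in $I$). If moreover $F$ is absolutely homogeneous, $F(x,\lambda y)=|\lambda|F(x,y)$ for all real $\lambda$, then the inequality holds for all $a,b\in I$. -/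

import Mathlib

open scoped Manifold ContDiff Topology

noncomputable section

namespace Finsler

/-! ### Calculus in a coordinate domain

Functions of coordinates `(x, y)`, where `x` is the position and `y` the fibre coordinate of a
tangent vector, are written as curried functions of two vectors of `ℝⁿ`. -/

/-- The coordinate space `ℝⁿ`. -/
abbrev Coord (n : ℕ) : Type := EuclideanSpace ℝ (Fin n)

/-- `∂f/∂xⁱ`, as a function of `(x, y)`. -/
def dX {n : ℕ} (i : Fin n) (f : Coord n → Coord n → ℝ) : Coord n → Coord n → ℝ :=
  fun x y => fderiv ℝ (fun x' => f x' y) x (EuclideanSpace.single i 1)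

/-- `∂f/∂yⁱ`, as a function of `(x, y)`. -/
def dY {n : ℕ} (i : Fin n) (f : Coord n → Coord n → ℝ) : Coord n → Coord n → ℝ :=
  fun x y => fderiv ℝ (fun y' => f x y') y (EuclideanSpace.single i 1)

/-- The fundamental tensor `g_{ij} = [½ L²]_{yⁱ yʲ}` of a Finsler function `L(x, y)`. -/
def metric {n : ℕ} (L : Coord n → Coord n → ℝ) (x y : Coord n) : Matrix (Fin n) (Fin n) ℝ :=
  Matrix.of fun i j => dY i (dY j (fun x' y' => (1 / 2) * L x' y' ^ 2)) x y

/-- The spray coefficients `Gⁱ = ½ gⁱˡ ([L²]_{xᵏ yˡ} yᵏ - [L²]_{xˡ})`;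
geodesics solve `xⁱ'' + Gⁱ(x, x') = 0`. -/
def spray {n : ℕ} (L : Coord n → Coord n → ℝ) (i : Fin n) (x y : Coord n) : ℝ :=
  (1 / 2) * ∑ l, (metric L x y)⁻¹ i l *
    ((∑ k, dX k (dY l (fun x' y' => L x' y' ^ 2)) x y * y k)
      - dX l (fun x' y' => L x' y' ^ 2) x y)

/-- The Riemann curvature `Rⁱ_k(x, y)`, homogeneous of degree two in `y`:
`2 Rⁱ_k = 2 (Gⁱ)_{xᵏ} - ½ (Gⁱ)_{yʲ} (Gʲ)_{yᵏ} - yʲ (Gⁱ)_{yᵏ xʲ} + Gʲ (Gⁱ)_{yᵏ yʲ}`. -/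
def riemann {n : ℕ} (L : Coord n → Coord n → ℝ) (i k : Fin n) (x y : Coord n) : ℝ :=
  (1 / 2) * (2 * dX k (spray L i) x y
    - (1 / 2) * ∑ j, dY j (spray L i) x y * dY k (spray L j) x y
    - ∑ j, y j * dX j (dY k (spray L i)) x y
    + ∑ j, spray L j x y * dY j (dY k (spray L i)) x y)

/-- The Ricci scalar, homogeneous of degree two in `y`: the trace `Rⁱ_i(x, y)`. It is equal to
`L²` times the trace of the curvature normalized to have degree zero in `y`. -/
def ricciScalar {n : ℕ} (L : Coord n → Coord n → ℝ) (x y : Coord n) : ℝ :=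
  ∑ i, riemann L i i x y

/-- The Ricci tensor of Akbar-Zadeh: half the Hessian in `y` of the Ricci scalar of
degree two. -/
def ricci {n : ℕ} (L : Coord n → Coord n → ℝ) (x y : Coord n) : Matrix (Fin n) (Fin n) ℝ :=
  Matrix.of fun i j => (1 / 2) * dY i (dY j (ricciScalar L)) x y

/-- The quadratic form `A_{ij} vⁱ vʲ`. -/
def quad {n : ℕ} (A : Matrix (Fin n) (Fin n) ℝ) (v : Coord n) : ℝ :=
  ∑ i, ∑ j, A i j * v i * v j

section Manifold

variable {n : ℕ} {M : Type*} [TopologicalSpace M] [ChartedSpace (Coord n) M]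

/-- The expression `(x, y) ↦ F(x, y)` of a function on the tangent bundle in the natural
coordinates of `TM` induced by the preferred chart `φ` of `M` at `q`: the pair `(x, y)` stands for
the tangent vector `d(φ⁻¹)_x(y)` at `φ⁻¹(x)`. Fundamental tensor, Ricci tensor and the geodesic
equation transform tensorially, so that it makes no difference which chart around `q` is used to
evaluate them at `q`. -/
def localExpr (F : TangentBundle (𝓡 n) M → ℝ) (q : M) : Coord n → Coord n → ℝ :=
  fun x y => F ⟨(chartAt (Coord n) q).symm x,
    mfderiv 𝓘(ℝ, Coord n) (𝓡 n) (chartAt (Coord n) q).symm x y⟩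

/-- A Finsler structure: a nonnegative function on `TM`, smooth on the slit tangent bundle,
positively homogeneous, with positive definite fundamental tensor on the slit tangent bundle. -/
structure IsFinsler [IsManifold (𝓡 n) ∞ M] (F : TangentBundle (𝓡 n) M → ℝ) : Prop where
  nonneg : ∀ v, 0 ≤ F v
  smooth : ContMDiffOn (𝓡 n).tangent 𝓘(ℝ, ℝ) ∞ F {v | v.snd ≠ 0}
  homogeneous : ∀ (q : M) (y : TangentSpace (𝓡 n) q) (r : ℝ), 0 < r →
    F ⟨q, r • y⟩ = r * F ⟨q, y⟩
  strongly_convex : ∀ (q : M) (y : Coord n), y ≠ 0 →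
    (metric (localExpr F q) (chartAt (Coord n) q q) y).PosDef

/-- Absolute homogeneity, `F(x, r y) = |r| F(x, y)` for all real `r`. -/
def IsAbsolutelyHomogeneous (F : TangentBundle (𝓡 n) M → ℝ) : Prop :=
  ∀ (q : M) (y : TangentSpace (𝓡 n) q) (r : ℝ), F ⟨q, r • y⟩ = |r| * F ⟨q, y⟩

/-- `Ric_{ij} ≤ -c² g_{ij}` as matrices, at every nonzero tangent vector `y`. -/
def RicciLE (F : TangentBundle (𝓡 n) M → ℝ) (c : ℝ) : Prop :=
  ∀ (q : M) (y : Coord n), y ≠ 0 → ∀ v : Coord n,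
    quad (ricci (localExpr F q) (chartAt (Coord n) q q) y) v
      ≤ -c ^ 2 * quad (metric (localExpr F q) (chartAt (Coord n) q q) y) v

/-- The velocity `γ'(t)` of a curve, as a point of the tangent bundle. -/
def velocity (γ : ℝ → M) (t : ℝ) : TangentBundle (𝓡 n) M :=
  ⟨γ t, mfderiv 𝓘(ℝ, ℝ) (𝓡 n) γ t (1 : ℝ)⟩

/-- The curve `γ` near time `t` in the preferred chart at `γ t`. -/
def coordCurve (γ : ℝ → M) (t : ℝ) : ℝ → Coord n :=
  fun r => chartAt (Coord n) (γ t) (γ r)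

/-- `γ` is piecewise `C^∞` on `[a, b]`: for some `a = t₀ < t₁ < ⋯ < tₘ = b` it is
`C^∞` on each `[tᵢ, tᵢ₊₁]`. -/
def IsPiecewiseSmooth (γ : ℝ → M) (a b : ℝ) : Prop :=
  ∃ (m : ℕ) (t : ℕ → ℝ), t 0 = a ∧ t m = b ∧
    ∀ i < m, t i < t (i + 1) ∧ ContMDiffOn 𝓘(ℝ, ℝ) (𝓡 n) ∞ γ (Set.Icc (t i) (t (i + 1)))

/-- The distance `d_F(x₀, x₁)`, the infimum of the lengths `∫ F(γ, γ') dt` of the piecewise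
`C^∞` curves from `x₀` to `x₁`. -/
def dist (F : TangentBundle (𝓡 n) M → ℝ) (x₀ x₁ : M) : ℝ :=
  sInf {ℓ : ℝ | ∃ (γ : ℝ → M) (a b : ℝ), a ≤ b ∧ IsPiecewiseSmooth (n := n) γ a b ∧
    γ a = x₀ ∧ γ b = x₁ ∧ ℓ = ∫ t in a..b, F (velocity γ t)}

/-- `x` is a geodesic of `F` on the open set `J` of times, parametrized by arc length. -/
structure IsUnitSpeedGeodesic (F : TangentBundle (𝓡 n) M → ℝ) (x : ℝ → M) (J : Set ℝ) :
    Prop where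
  smooth : ContMDiffOn 𝓘(ℝ, ℝ) (𝓡 n) ∞ x J
  unit_speed : ∀ s ∈ J, F (velocity x s) = 1
  geodesic : ∀ s ∈ J, ∀ i : Fin n,
    deriv (deriv (coordCurve x s)) s i
      + spray (localExpr F (x s)) i (coordCurve x s s) (deriv (coordCurve x s) s) = 0

/-- `Ric_{jk}(x, x') x'ʲ x'ᵏ` along a curve `x`, at time `s`. -/
def ricciAlong (F : TangentBundle (𝓡 n) M → ℝ) (x : ℝ → M) (s : ℝ) : ℝ :=
  quad (ricci (localExpr F (x s)) (coordCurve x s s) (deriv (coordCurve x s) s))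
    (deriv (coordCurve x s) s)

/-- The Schwarzian derivative `{p, s} = p''' / p' - (3/2) (p'' / p')²`. -/
def schwarzian (p : ℝ → ℝ) (s : ℝ) : ℝ :=
  iteratedDeriv 3 p s / deriv p s - (3 / 2) * (iteratedDeriv 2 p s / deriv p s) ^ 2

/-- The map `f : (-1, 1) → M` is projective: it is a geodesic whose natural parameter is a
projective parameter. Here `x : J → M` is the geodesic in its arc-length parametrization, on an
open interval `J`, and `p : J → (-1, 1)` is the projective parameter, so that `f (p s) = x s`.
Projective parameters may increase or decrease along the geodesic. -/
structure IsProjectiveMap (F : TangentBundle (𝓡 n) M → ℝ) (f : ℝ → M)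
    (J : Set ℝ) (x : ℝ → M) (p : ℝ → ℝ) : Prop where
  isOpen : IsOpen J
  ordConnected : J.OrdConnected
  geodesic : IsUnitSpeedGeodesic F x J
  smooth : ContDiffOn ℝ ∞ p J
  deriv_ne_zero : ∀ s ∈ J, deriv p s ≠ 0
  image_eq : p '' J = Set.Ioo (-1) 1
  schwarzian_eq : ∀ s ∈ J, schwarzian p s = 2 / ((n : ℝ) - 1) * ricciAlong F x s
  comp_eq : ∀ s ∈ J, f (p s) = x s

end Manifold

/-- The Poincaré distance `|ln ((1 - a)(1 + b) / ((1 - b)(1 + a)))|` on `(-1, 1)`. -/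
def poincareDist (a b : ℝ) : ℝ :=
  |Real.log (((1 - a) * (1 + b)) / ((1 - b) * (1 + a)))|

end Finsler

end

namespace Finsler

/-! The curvature enters only through the projective parameter. By Euler's identity `g_{ij} yⁱ yʲ =
F²`, so along a unit-speed geodesic the Ricci bound gives `Ric(x', x') ≤ -c²`. The projective
equation then becomes `{p, s} ≤ -2k²` with `k = c / √(n - 1)`.

What remains is a one-dimensional Schwarz lemma of Ahlfors type: `p' ≥ k (1 - p²)` for increasing
`p` (`mul_one_sub_sq_le_deriv`). On the preimage of `[-r, r]`, `r < 1`, the quotient `u = (r² - p²)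
/ p'` vanishes at both ends and so has an interior maximum. There `(log u)' = 0` and `(log u)'' ≤
0`, which combine to `k ≤ r p' / (r² - p²)`. Maximality of `u` carries this bound to every point of
the interval, and `r → 1` gives the claim (`le_deriv_div_of_schwarzian_le`).

Integrating `(log ((1 + p) / (1 - p)))' = 2 p' / (1 - p²) ≥ 2k` gives `ρ ≥ 2k (s₂ - s₁)`
(`le_poincareDist`). The geodesic arc has length `s₂ - s₁`, which bounds `d_F` from above. For the
opposite direction the arc is reversed, at the same length when `F` is absolutely homogeneous. -/

/-! ### The Schwarz lemma for the Schwarzian derivative. -/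

/-- If `f'' > 0`, the second derivative test makes `x` a local minimum as well, so `f` is constant
near `x` and `f'' = 0`. -/
theorem deriv_deriv_nonpos_of_isLocalMax {f f' : ℝ → ℝ} {x f'' : ℝ}
    (h1 : ∀ᶠ y in 𝓝 x, HasDerivAt f (f' y) y) (h2 : HasDerivAt f' f'' x) (hmax : IsLocalMax f x) :
    f'' ≤ 0 := by
  by_contra! hpos
  have hd : deriv f =ᶠ[𝓝 x] f' := h1.mono fun y hy => hy.deriv
  have hdd : deriv (deriv f) x = f'' := by rw [hd.deriv_eq, h2.deriv]
  have hmin : IsLocalMin f x := isLocalMin_of_deriv_deriv_pos (by rw [hdd]; exact hpos)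
    hmax.deriv_eq_zero h1.self_of_nhds.continuousAt
  have hconst : f =ᶠ[𝓝 x] fun _ => f x := by
    filter_upwards [hmin, hmax] with y hy1 hy2 using le_antisymm hy2 hy1
  have hz : deriv f =ᶠ[𝓝 x] fun _ => 0 := by
    refine hconst.deriv.trans (Filter.Eventually.of_forall fun y => ?_)
    simp
  have := hz.deriv_eq
  rw [hdd] at this
  simp at this
  exact hpos.ne' this

/-- Comparison with the Poincaré metric of `(-r, r)` for one parametrization of an interval. -/
theorem le_deriv_div_of_schwarzian_le {p p₁ p₂ p₃ : ℝ → ℝ} {α β k r : ℝ} (hr : 0 < r)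
    (h0 : ∀ s ∈ Set.Icc α β, HasDerivAt p (p₁ s) s)
    (h1 : ∀ s ∈ Set.Icc α β, HasDerivAt p₁ (p₂ s) s)
    (h2 : ∀ s ∈ Set.Icc α β, HasDerivAt p₂ (p₃ s) s)
    (hpos : ∀ s ∈ Set.Icc α β, 0 < p₁ s)
    (hα : p α = -r) (hβ : p β = r)
    (hS : ∀ s ∈ Set.Icc α β, p₃ s / p₁ s - 3 / 2 * (p₂ s / p₁ s) ^ 2 ≤ -2 * k ^ 2)
    (hin : ∀ s ∈ Set.Ioo α β, p s ^ 2 < r ^ 2) {s₀ : ℝ} (hs₀ : s₀ ∈ Set.Ioo α β) :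
    k * (r ^ 2 - p s₀ ^ 2) ≤ r * p₁ s₀ := by
  have hne : ∀ s ∈ Set.Icc α β, p₁ s ≠ 0 := fun s hs => (hpos s hs).ne'
  have hcont : ContinuousOn (fun s => (r ^ 2 - p s ^ 2) / p₁ s) (Set.Icc α β) := by
    have hc0 : ContinuousOn p (Set.Icc α β) := fun s hs => (h0 s hs).continuousAt.continuousWithinAt
    have hc1 : ContinuousOn p₁ (Set.Icc α β) := fun s hs => (h1 s hs).continuousAt.continuousWithinAt
    exact (continuousOn_const.sub (hc0.pow 2)).div hc1 hne
  have hs₀' := Set.Ioo_subset_Icc_self hs₀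
  obtain ⟨s, hs, hmax⟩ := isCompact_Icc.exists_isMaxOn ⟨s₀, hs₀'⟩ hcont
  have hm0 : 0 < (r ^ 2 - p s₀ ^ 2) / p₁ s₀ :=
    div_pos (sub_pos.2 (hin s₀ hs₀)) (hpos s₀ hs₀')
  have hms : (r ^ 2 - p s₀ ^ 2) / p₁ s₀ ≤ (r ^ 2 - p s ^ 2) / p₁ s := hmax hs₀'
  have hsI : s ∈ Set.Ioo α β := by
    refine ⟨lt_of_le_of_ne hs.1 ?_, lt_of_le_of_ne hs.2 ?_⟩
    · rintro rfl
      rw [hα] at hms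
      norm_num at hms
      exact absurd hms (not_le.2 hm0)
    · rintro rfl
      rw [hβ] at hms
      norm_num at hms
      exact absurd hms (not_le.2 hm0)
  have hnhds : ∀ᶠ t in 𝓝 s, t ∈ Set.Ioo α β := isOpen_Ioo.mem_nhds hsI
  have hD : ∀ t ∈ Set.Ioo α β, r ^ 2 - p t ^ 2 ≠ 0 := fun t ht => (sub_pos.2 (hin t ht)).ne'
  have hDp : ∀ t ∈ Set.Ioo α β,
      HasDerivAt (fun t => r ^ 2 - p t ^ 2) (-(2 * p t * p₁ t)) t := fun t ht => by
    have := ((h0 t (Set.Ioo_subset_Icc_self ht)).pow 2).const_sub (r ^ 2)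
    simpa using this
  have hlog : ∀ t ∈ Set.Ioo α β, HasDerivAt
      (fun t => Real.log (r ^ 2 - p t ^ 2) - Real.log (p₁ t))
      (-(2 * p t * p₁ t) / (r ^ 2 - p t ^ 2) - p₂ t / p₁ t) t := fun t ht =>
    ((hDp t ht).log (hD t ht)).sub
      ((h1 t (Set.Ioo_subset_Icc_self ht)).log (hne t (Set.Ioo_subset_Icc_self ht)))
  -- The logarithm keeps the maximum and makes the derivatives of `p'` appear as `p'' / p'`, as in
  -- the Schwarzian.
  have hlmax : IsLocalMax (fun t => Real.log (r ^ 2 - p t ^ 2) - Real.log (p₁ t)) s := by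
    filter_upwards [hnhds] with t ht
    have htI := Set.Ioo_subset_Icc_self ht
    rw [← Real.log_div (hD t ht) (hne t htI), ← Real.log_div (hD s hsI) (hne s hs)]
    exact Real.log_le_log (div_pos (sub_pos.2 (hin t ht)) (hpos t htI)) (hmax htI)
  have hcrit := hlmax.hasDerivAt_eq_zero (hlog s hsI)
  have hsecond := deriv_deriv_nonpos_of_isLocalMax (hnhds.mono hlog)
    ((((((h0 s hs).const_mul 2).mul (h1 s hs)).neg).div (hDp s hsI) (hD s hsI)).sub
      ((h2 s hs).div (h1 s hs) (hne s hs))) hlmax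
  have hSs := hS s hs
  have hp := hpos s hs
  have hDs : 0 < r ^ 2 - p s ^ 2 := sub_pos.2 (hin s hsI)
  have key : k ^ 2 ≤ (r * p₁ s / (r ^ 2 - p s ^ 2)) ^ 2 := by
    set D := r ^ 2 - p s ^ 2 with hDdef
    have hA : p₂ s / p₁ s = -(2 * p s * p₁ s) / D := by linarith
    have hr2 : r ^ 2 = D + p s ^ 2 := by rw [hDdef]; ring
    have hA' : p₂ s = -(2 * p s * p₁ s) / D * p₁ s := by
      rw [← hA]; field_simp
    -- Substituting the critical point equation `p'' / p' = -2 p p' / D` turns `(log u)''` into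
    -- `-({p, s} + 2 (r p' / D)²)`.
    have e : p₃ s / p₁ s - 3 / 2 * (p₂ s / p₁ s) ^ 2 + 2 * (r * p₁ s / D) ^ 2 =
      -((-(2 * p₁ s * p₁ s + 2 * p s * p₂ s) * D -
        -(2 * p s * p₁ s) * -(2 * p s * p₁ s)) / D ^ 2 -
        (p₃ s * p₁ s - p₂ s * p₂ s) / p₁ s ^ 2) := by
      rw [div_pow (r * p₁ s), mul_pow, hr2, hA']
      field_simp
      ring
    have hsec' : ((-(2 * p₁ s * p₁ s + 2 * p s * p₂ s) * D -
        -(2 * p s * p₁ s) * -(2 * p s * p₁ s)) / D ^ 2 -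
        (p₃ s * p₁ s - p₂ s * p₂ s) / p₁ s ^ 2) ≤ 0 := by
      simpa using hsecond
    linarith
  have hk : k ≤ r * p₁ s / (r ^ 2 - p s ^ 2) :=
    (le_abs_self k).trans (abs_le_of_sq_le_sq key (by positivity))
  rw [div_le_div_iff₀ (hpos s₀ hs₀') hp] at hms
  rw [le_div_iff₀ hDs] at hk
  have hD0 := sub_pos.2 (hin s₀ hs₀)
  refine le_of_mul_le_mul_right ?_ hDs
  nlinarith [mul_le_mul_of_nonneg_right hk hD0.le, mul_le_mul_of_nonneg_left hms hr.le]

/-- The Schwarz lemma for a projective parameter with negative Schwarzian, increasing case. -/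
theorem mul_one_sub_sq_le_deriv {p : ℝ → ℝ} {J : Set ℝ} {k : ℝ} (hJ : IsOpen J)
    (hJc : J.OrdConnected) (hp : ContDiffOn ℝ ∞ p J) (hpos : ∀ s ∈ J, 0 < deriv p s)
    (himg : p '' J = Set.Ioo (-1) 1) (hS : ∀ s ∈ J, schwarzian p s ≤ -2 * k ^ 2)
    {s₀ : ℝ} (hs₀ : s₀ ∈ J) : k * (1 - p s₀ ^ 2) ≤ deriv p s₀ := by
  have hd : ∀ m : ℕ, ∀ s ∈ J, HasDerivAt (iteratedDeriv m p) (iteratedDeriv (m + 1) p s) s := by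
    intro m s hs
    have hc : ∀ m : ℕ, ContDiffOn ℝ ∞ (iteratedDeriv m p) J := fun m => by
      induction m with
      | zero => simpa using hp
      | succ m ih =>
        rw [iteratedDeriv_succ]
        exact ih.deriv_of_isOpen hJ (by simp)
    have : DifferentiableAt ℝ (iteratedDeriv m p) s :=
      ((hc m).contDiffAt (hJ.mem_nhds hs)).differentiableAt (by simp)
    rw [iteratedDeriv_succ]
    exact this.hasDerivAt
  have hd0 : ∀ s ∈ J, HasDerivAt p (deriv p s) s := fun s hs => by
    simpa [iteratedDeriv_one] using hd 0 s hs
  have hmono : StrictMonoOn p J := strictMonoOn_of_deriv_pos hJc.convex hp.continuousOn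
    fun s hs => hpos s (interior_subset hs)
  have hmem : p s₀ ∈ Set.Ioo (-1 : ℝ) 1 := himg ▸ Set.mem_image_of_mem p hs₀
  have habs : |p s₀| < 1 := abs_lt.2 hmem
  -- With `r < 1` the preimage of `[-r, r]` is a compact interval inside `J`; no control of `p` near
  -- the ends of `J` is needed.
  have hlt : ∀ r ∈ Set.Ioo |p s₀| 1, k * (r ^ 2 - p s₀ ^ 2) ≤ r * deriv p s₀ := by
    intro r hr
    have hr0 : 0 < r := (abs_nonneg _).trans_lt hr.1
    obtain ⟨α, hα, hpα⟩ : -r ∈ p '' J := himg ▸ ⟨by linarith [hr.2], by linarith⟩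
    obtain ⟨β, hβ, hpβ⟩ : r ∈ p '' J := himg ▸ ⟨by linarith, hr.2⟩
    have hsub : Set.Icc α β ⊆ J := hJc.out hα hβ
    have hb := abs_lt.1 hr.1
    refine le_deriv_div_of_schwarzian_le (p₁ := deriv p) (p₂ := iteratedDeriv 2 p)
      (p₃ := iteratedDeriv 3 p) hr0 (fun s hs => hd0 s (hsub hs))
      (fun s hs => ?_) (fun s hs => hd 2 s (hsub hs)) (fun s hs => hpos s (hsub hs)) hpα hpβ
      (fun s hs => hS s (hsub hs)) (fun s hs => ?_) ⟨?_, ?_⟩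
    · simpa [iteratedDeriv_one] using hd 1 s (hsub hs)
    · have hsJ := hsub (Set.Ioo_subset_Icc_self hs)
      have h1 := hmono hα hsJ hs.1
      have h2 := hmono hsJ hβ hs.2
      exact sq_lt_sq' (by linarith) (by linarith)
    · exact (hmono.lt_iff_lt hα hs₀).1 (by linarith)
    · exact (hmono.lt_iff_lt hs₀ hβ).1 (by linarith)
  have hev : ∀ᶠ r in 𝓝[<] (1 : ℝ), k * (r ^ 2 - p s₀ ^ 2) ≤ r * deriv p s₀ := by
    filter_upwards [Ioo_mem_nhdsLT habs] with r hr using hlt r hr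
  have hl : Filter.Tendsto (fun r : ℝ => k * (r ^ 2 - p s₀ ^ 2)) (𝓝[<] 1)
      (𝓝 (k * (1 ^ 2 - p s₀ ^ 2))) :=
    (Continuous.tendsto (by fun_prop) (1 : ℝ)).mono_left nhdsWithin_le_nhds
  have hr : Filter.Tendsto (fun r : ℝ => r * deriv p s₀) (𝓝[<] 1) (𝓝 (1 * deriv p s₀)) :=
    (Continuous.tendsto (by fun_prop) (1 : ℝ)).mono_left nhdsWithin_le_nhds
  simpa using le_of_tendsto_of_tendsto hl hr hev

/-! ### Expansion of the Poincaré distance. -/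

theorem poincareDist_eq_abs_sub {a b : ℝ} (ha : a ∈ Set.Ioo (-1 : ℝ) 1)
    (hb : b ∈ Set.Ioo (-1 : ℝ) 1) : poincareDist a b =
      |(Real.log (1 + b) - Real.log (1 - b)) - (Real.log (1 + a) - Real.log (1 - a))| := by
  have h1 : 1 - a ≠ 0 := by linarith [ha.2]
  have h2 : 1 + a ≠ 0 := by linarith [ha.1]
  have h3 : 1 - b ≠ 0 := by linarith [hb.2]
  have h4 : 1 + b ≠ 0 := by linarith [hb.1]
  rw [poincareDist, Real.log_div (mul_ne_zero h1 h4) (mul_ne_zero h3 h2), Real.log_mul h1 h4,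
    Real.log_mul h3 h2]
  congr 1
  ring

theorem poincareDist_comm (a b : ℝ) : poincareDist a b = poincareDist b a := by
  rw [poincareDist, poincareDist, ← abs_neg, ← Real.log_inv, inv_div]

theorem poincareDist_neg (a b : ℝ) : poincareDist (-a) (-b) = poincareDist a b := by
  rw [poincareDist_comm, poincareDist, poincareDist]
  congr 2
  ring

theorem schwarzian_neg (p : ℝ → ℝ) (s : ℝ) : schwarzian (-p) s = schwarzian p s := by
  simp [schwarzian, iteratedDeriv_neg, deriv.neg, neg_div_neg_eq]

/-- The Schwarz lemma bounds the derivative of `log (1 + p) - log (1 - p)` below by `2k`; the mean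
value inequality integrates this. -/
theorem le_poincareDist_of_deriv_pos {p : ℝ → ℝ} {J : Set ℝ} {k : ℝ} (hJ : IsOpen J)
    (hJc : J.OrdConnected) (hp : ContDiffOn ℝ ∞ p J) (hpos : ∀ s ∈ J, 0 < deriv p s)
    (himg : p '' J = Set.Ioo (-1) 1) (hS : ∀ s ∈ J, schwarzian p s ≤ -2 * k ^ 2)
    {s₁ s₂ : ℝ} (h₁ : s₁ ∈ J) (h₂ : s₂ ∈ J) (h : s₁ ≤ s₂) :
    2 * k * (s₂ - s₁) ≤ poincareDist (p s₁) (p s₂) := by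
  have hmem : ∀ s ∈ J, p s ∈ Set.Ioo (-1 : ℝ) 1 := fun s hs =>
    himg ▸ Set.mem_image_of_mem p hs
  have hU : ∀ s ∈ J, HasDerivAt (fun s => Real.log (1 + p s) - Real.log (1 - p s))
      (2 * deriv p s / (1 - p s ^ 2)) s := by
    intro s hs
    have hps := hmem s hs
    have hd : HasDerivAt p (deriv p s) s := ((hp.contDiffAt (hJ.mem_nhds hs)).differentiableAt
      (by simp)).hasDerivAt
    have h3 : 1 - p s ≠ 0 := by linarith [hps.2]
    have h4 : 1 + p s ≠ 0 := by linarith [hps.1]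
    refine (((hd.const_add 1).log h4).sub ((hd.const_sub 1).log h3)).congr_deriv ?_
    have : 1 - p s ^ 2 = (1 - p s) * (1 + p s) := by ring
    rw [this]
    field_simp
    ring
  rw [poincareDist_eq_abs_sub (hmem _ h₁) (hmem _ h₂)]
  refine le_trans ?_ (le_abs_self _)
  refine Convex.mul_sub_le_image_sub_of_le_deriv (D := J)
    (f := fun s => Real.log (1 + p s) - Real.log (1 - p s)) hJc.convex
    (fun s hs => (hU s hs).continuousAt.continuousWithinAt)
    (fun s hs => (hU s (interior_subset hs)).differentiableAt.differentiableWithinAt)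
    (fun s hs => ?_) s₁ h₁ s₂ h₂ h
  have hs := interior_subset hs
  have hps := hmem s hs
  rw [(hU s hs).deriv, le_div_iff₀ (by nlinarith [hps.1, hps.2])]
  have := mul_one_sub_sq_le_deriv hJ hJc hp hpos himg hS hs
  linarith

/-- A projective parameter with Schwarzian at most `-2k²` expands the Poincaré distance by at
least `2k`. -/
theorem le_poincareDist {p : ℝ → ℝ} {J : Set ℝ} {k : ℝ} (hJ : IsOpen J)
    (hJc : J.OrdConnected) (hp : ContDiffOn ℝ ∞ p J) (hne : ∀ s ∈ J, deriv p s ≠ 0)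
    (himg : p '' J = Set.Ioo (-1) 1) (hS : ∀ s ∈ J, schwarzian p s ≤ -2 * k ^ 2)
    {s₁ s₂ : ℝ} (h₁ : s₁ ∈ J) (h₂ : s₂ ∈ J) (h : s₁ ≤ s₂) :
    2 * k * (s₂ - s₁) ≤ poincareDist (p s₁) (p s₂) := by
  have hd : ∀ s ∈ J, HasDerivWithinAt p (deriv p s) J s := fun s hs =>
    ((hp.contDiffAt (hJ.mem_nhds hs)).differentiableAt (by simp)).hasDerivAt.hasDerivWithinAt
  -- By Darboux `p'` has one sign on `J`; replacing `p` by `-p` changes neither the Schwarzian nor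
  -- the Poincaré distance.
  rcases hasDerivWithinAt_forall_lt_or_forall_gt_of_forall_ne hJc.convex hd hne with hneg | hpos
  · rw [← poincareDist_neg]
    refine le_poincareDist_of_deriv_pos (p := -p) hJ hJc hp.neg (fun s hs => ?_) ?_
      (fun s hs => ?_) h₁ h₂ h
    · rw [deriv.neg]
      exact neg_pos.2 (hneg s hs)
    · have : (-p) '' J = Neg.neg '' (p '' J) := by rw [Set.image_image]; rfl
      rw [this, himg]
      simp
    · rw [schwarzian_neg]
      exact hS s hs
  · exact le_poincareDist_of_deriv_pos hJ hJc hp hpos himg hS h₁ h₂ h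

/-! ### Euler's identity and the fundamental tensor. -/

theorem Coord.sum_smul_single {n : ℕ} (y : Coord n) :
    ∑ i, y i • (EuclideanSpace.single i 1 : Coord n) = y := by
  simpa using (EuclideanSpace.basisFun (Fin n) ℝ).sum_repr y

theorem Coord.sum_apply_single_apply_single {n : ℕ}
    (B : Coord n →L[ℝ] Coord n →L[ℝ] ℝ) (y : Coord n) :
    ∑ i, ∑ j, B (EuclideanSpace.single i 1) (EuclideanSpace.single j 1) * y i * y j = B y y := by
  have hlin : ∀ A : Coord n →L[ℝ] ℝ, A y = ∑ j, A (EuclideanSpace.single j 1) * y j := fun A => by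
    conv_lhs => rw [← Coord.sum_smul_single y]
    simp [map_sum, mul_comm]
  have hy := hlin (B.flip y)
  simp only [ContinuousLinearMap.flip_apply] at hy
  rw [hy]
  refine Finset.sum_congr rfl fun i _ => ?_
  rw [hlin, Finset.sum_mul]
  exact Finset.sum_congr rfl fun j _ => by ring

/-- Euler's identity for the second derivatives of a function homogeneous of degree two. -/
theorem sum_fderiv_fderiv_eq_two_mul {n : ℕ} {g : Coord n → ℝ} {y : Coord n}
    (hg : ContDiffAt ℝ 2 g y) (hhom : ∀ t : ℝ, 0 < t → g (t • y) = t ^ 2 * g y) :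
    ∑ i, ∑ j, fderiv ℝ (fun z => fderiv ℝ g z (EuclideanSpace.single j 1)) y
      (EuclideanSpace.single i 1) * y i * y j = 2 * g y := by
  have hD : DifferentiableAt ℝ (fderiv ℝ g) y :=
    (hg.fderiv_right (m := 1) (by norm_num)).differentiableAt (by simp)
  have hpart : ∀ v w : Coord n, fderiv ℝ (fun z => fderiv ℝ g z w) y v =
      fderiv ℝ (fderiv ℝ g) y v w := by
    intro v w
    rw [(hD.hasFDerivAt.clm_apply (hasFDerivAt_const w y)).fderiv]
    simp
  simp only [hpart]
  rw [Coord.sum_apply_single_apply_single]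
  have hline : ∀ t : ℝ, HasDerivAt (fun t : ℝ => t • y) y t := fun t => by
    simpa using (hasDerivAt_id t).smul_const y
  have hev : ∀ᶠ z in 𝓝 y, DifferentiableAt ℝ g z :=
    (hg.eventually (by simp)).mono fun z hz => hz.differentiableAt (by simp)
  have htend : Filter.Tendsto (fun t : ℝ => t • y) (𝓝 1) (𝓝 y) := by
    simpa using (hline 1).continuousAt.tendsto
  -- Homogeneity is differentiated along the ray `t ↦ t y`: once for all `t` near `1`, so that the
  -- result can be differentiated again at `t = 1`.
  have hfirst : ∀ᶠ t : ℝ in 𝓝 1, fderiv ℝ g (t • y) y = 2 * t * g y := by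
    filter_upwards [htend.eventually hev, lt_mem_nhds (zero_lt_one (α := ℝ))] with t ht ht0
    have h1 : HasDerivAt (fun t : ℝ => g (t • y)) (fderiv ℝ g (t • y) y) t :=
      ht.hasFDerivAt.comp_hasDerivAt t (hline t)
    have h2 : HasDerivAt (fun t : ℝ => t ^ 2 * g y) (2 * t * g y) t := by
      simpa using (hasDerivAt_pow 2 t).mul_const (g y)
    refine h1.unique (h2.congr_of_eventuallyEq ?_)
    filter_upwards [lt_mem_nhds ht0] with r hr using hhom r hr
  have h3 : HasDerivAt (fun t : ℝ => fderiv ℝ g (t • y) y) (fderiv ℝ (fderiv ℝ g) y y y) 1 := by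
    have hΦ : DifferentiableAt ℝ (fun z => fderiv ℝ g z y) ((1 : ℝ) • y) := by
      rw [one_smul]
      exact hD.clm_apply (differentiableAt_const y)
    have := hΦ.hasFDerivAt.comp_hasDerivAt (1 : ℝ) (hline 1)
    rwa [one_smul, hpart] at this
  have h4 : HasDerivAt (fun t : ℝ => 2 * t * g y) (2 * g y) 1 := by
    simpa using ((hasDerivAt_id (1 : ℝ)).const_mul 2).mul_const (g y)
  exact h3.unique (h4.congr_of_eventuallyEq hfirst)

/-- `g_{ij}(x, y) yⁱ yʲ = L(x, y)²`. -/
theorem quad_metric_self {n : ℕ} {L : Coord n → Coord n → ℝ} {x y : Coord n}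
    (hL : ContDiffAt ℝ 2 (L x) y) (hhom : ∀ t : ℝ, 0 < t → L x (t • y) = t * L x y) :
    quad (metric L x y) y = L x y ^ 2 := by
  have := sum_fderiv_fderiv_eq_two_mul (g := fun y' => (1 / 2) * L x y' ^ 2)
    (contDiffAt_const.mul (hL.pow 2)) (fun t ht => by simp only [hhom t ht]; ring)
  simp only [quad, metric, Matrix.of_apply, dY]
  rw [this]
  ring

/-! ### Finsler speed, length and Ricci curvature along a geodesic. -/

variable {n : ℕ} {M : Type*} [TopologicalSpace M] [ChartedSpace (Coord n) M]
  {F : TangentBundle (𝓡 n) M → ℝ}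

theorem velocity_comp_neg {x : ℝ → M} {t : ℝ}
    (hx : MDifferentiableAt 𝓘(ℝ, ℝ) (𝓡 n) x (-t)) :
    velocity (n := n) (fun r => x (-r)) t = ⟨x (-t), -(velocity (n := n) x (-t)).snd⟩ := by
  have hneg : HasMFDerivAt 𝓘(ℝ, ℝ) 𝓘(ℝ, ℝ) (fun r : ℝ => -r) t (-ContinuousLinearMap.id ℝ ℝ) :=
    (hasFDerivAt_id t).neg.hasMFDerivAt
  have h := (hx.hasMFDerivAt.comp t hneg).mfderiv
  refine congrArg (Bundle.TotalSpace.mk (x (-t))) ?_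
  refine (congrArg (fun A => A (1 : ℝ)) h).trans ?_
  change (mfderiv 𝓘(ℝ, ℝ) (𝓡 n) x (-t)) (-1 : ℝ) = - (mfderiv 𝓘(ℝ, ℝ) (𝓡 n) x (-t)) (1 : ℝ)
  exact map_neg _ _

theorem IsUnitSpeedGeodesic.mdifferentiableAt {x : ℝ → M} {J : Set ℝ}
    (hx : IsUnitSpeedGeodesic F x J) (hJ : IsOpen J) {s : ℝ} (hs : s ∈ J) :
    MDifferentiableAt 𝓘(ℝ, ℝ) (𝓡 n) x s :=
  (hx.smooth.contMDiffAt (hJ.mem_nhds hs)).mdifferentiableAt (by simp)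

variable [IsManifold (𝓡 n) ∞ M]

theorem IsFinsler.apply_zero (hF : IsFinsler F) (q : M) :
    F ⟨q, (0 : TangentSpace (𝓡 n) q)⟩ = 0 := by
  have := hF.homogeneous q 0 2 two_pos
  rw [smul_zero] at this
  linarith

theorem IsFinsler.contDiffAt_fiber (hF : IsFinsler F) (q : M) {y : Coord n} (hy : y ≠ 0) :
    ContDiffAt ℝ ∞ (fun v : Coord n => F ⟨q, v⟩) y := by
  have hincl : ContMDiffAt 𝓘(ℝ, Coord n) (𝓡 n).tangent ∞
      (fun v : Coord n => (⟨q, v⟩ : TangentBundle (𝓡 n) M)) y := by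
    rw [Bundle.contMDiffAt_totalSpace]
    refine ⟨contMDiffAt_const, ?_⟩
    -- Read in the trivialization at `q`, the inclusion of the fibre over `q` is a continuous linear
    -- map, hence smooth.
    have heq : (fun v : Coord n => (trivializationAt (Coord n) (TangentSpace (𝓡 n)) q
        (⟨q, v⟩ : TangentBundle (𝓡 n) M)).2) =
        (trivializationAt (Coord n) (TangentSpace (𝓡 n) (M := M)) q).continuousLinearMapAt ℝ q := by
      exact (Bundle.Trivialization.coe_linearMapAt_of_mem (R := ℝ)
        (trivializationAt (Coord n) (TangentSpace (𝓡 n) (M := M)) q)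
        (FiberBundle.mem_baseSet_trivializationAt' q)).symm
    change ContMDiffAt _ _ _ (fun v : Coord n => (trivializationAt (Coord n) (TangentSpace (𝓡 n)) q
        (⟨q, v⟩ : TangentBundle (𝓡 n) M)).2) y
    rw [heq]
    exact (ContinuousLinearMap.contDiff (E := Coord n) (F := Coord n) _).contMDiff.contMDiffAt
  have h := ContMDiffWithinAt.comp (s := {v : Coord n | v ≠ 0}) y (hF.smooth ⟨q, y⟩ hy)
    hincl.contMDiffWithinAt fun v hv => hv
  exact (h.contMDiffAt (isOpen_ne.mem_nhds hy)).contDiffAt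

theorem IsFinsler.quad_metric_localExpr (hF : IsFinsler F) (q : M) {y : Coord n} (hy : y ≠ 0) :
    quad (metric (localExpr F q) (chartAt (Coord n) q q) y) y
      = localExpr F q (chartAt (Coord n) q q) y ^ 2 := by
  have hinj := (mdifferentiable_chart (I := 𝓡 n) q).symm.mfderiv_injective
    (mem_chart_target (Coord n) q)
  refine quad_metric_self ?_ fun t ht => ?_
  · have hne : mfderiv 𝓘(ℝ, Coord n) (𝓡 n) (chartAt (Coord n) q).symm (chartAt (Coord n) q q) y
        ≠ 0 := fun h => hy (hinj (h.trans (map_zero _).symm))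
    have := (hF.contDiffAt_fiber ((chartAt (Coord n) q).symm (chartAt (Coord n) q q)) hne).comp y
      (ContinuousLinearMap.contDiff (E := Coord n) (F := Coord n)
        (mfderiv 𝓘(ℝ, Coord n) (𝓡 n) (chartAt (Coord n) q).symm
          (chartAt (Coord n) q q))).contDiffAt
    exact_mod_cast contDiffAt_infty.1 this 2
  · have hlin := map_smul (mfderiv 𝓘(ℝ, Coord n) (𝓡 n) (chartAt (Coord n) q).symm
      (chartAt (Coord n) q q)) t y
    exact (congrArg (fun w => F ⟨(chartAt (Coord n) q).symm (chartAt (Coord n) q q), w⟩)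
      hlin).trans (hF.homogeneous _ _ t ht)

/-- The local expression of `F` at the coordinate velocity of a curve is the speed. -/
theorem localExpr_deriv_coordCurve (F : TangentBundle (𝓡 n) M → ℝ) {x : ℝ → M} {s : ℝ}
    (hx : MDifferentiableAt 𝓘(ℝ, ℝ) (𝓡 n) x s) :
    localExpr F (x s) (chartAt (Coord n) (x s) (x s)) (deriv (coordCurve x s) s)
      = F (velocity x s) := by
  have hchart := mdifferentiable_chart (I := 𝓡 n) (x s)
  have hcomp : mfderiv 𝓘(ℝ, ℝ) 𝓘(ℝ, Coord n) (coordCurve x s) s =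
      (mfderiv (𝓡 n) (𝓡 n) (chartAt (Coord n) (x s)) (x s)).comp
        (mfderiv 𝓘(ℝ, ℝ) (𝓡 n) x s) :=
    mfderiv_comp s (hchart.mdifferentiableAt (mem_chart_source _ _)) hx
  have hderiv : deriv (coordCurve x s) s =
      mfderiv (𝓡 n) (𝓡 n) (chartAt (Coord n) (x s)) (x s)
        (mfderiv 𝓘(ℝ, ℝ) (𝓡 n) x s (1 : ℝ)) := by
    rw [← fderiv_apply_one_eq_deriv, ← mfderiv_eq_fderiv, hcomp]
    rfl
  have hinv := congrArg (fun A => A (mfderiv 𝓘(ℝ, ℝ) (𝓡 n) x s (1 : ℝ)))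
    (hchart.symm_comp_deriv (mem_chart_source (Coord n) (x s)))
  -- The base points `φ⁻¹(φ(x s))` and `x s` are equal but not by definition, so the vectors are
  -- compared as elements of `Coord n`.
  have hbase : ∀ (a b : M) (_ : a = b) (v w : Coord n) (_ : v = w),
      F ⟨a, v⟩ = F ⟨b, w⟩ := by
    rintro a _ rfl v _ rfl
    rfl
  rw [localExpr, hderiv, velocity]
  exact hbase _ _ ((chartAt (Coord n) (x s)).left_inv (mem_chart_source _ _)) _ _ hinv

theorem dist_le_of_unit_speed (hF : IsFinsler F) {γ : ℝ → M} {a b : ℝ} (hab : a ≤ b)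
    (hγ : ContMDiffOn 𝓘(ℝ, ℝ) (𝓡 n) ∞ γ (Set.Icc a b))
    (hspeed : ∀ t ∈ Set.Icc a b, F (velocity γ t) = 1) : dist F (γ a) (γ b) ≤ b - a := by
  refine csInf_le ⟨0, ?_⟩ ⟨γ, a, b, hab, ?_, rfl, rfl, ?_⟩
  · rintro ℓ ⟨γ, a, b, hab, -, -, -, rfl⟩
    exact intervalIntegral.integral_nonneg hab fun t _ => hF.nonneg _
  · rcases hab.eq_or_lt with rfl | hlt
    -- A partition has strictly increasing nodes, so the degenerate interval needs `m = 0`, with no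
    -- pieces.
    · exact ⟨0, fun _ => a, rfl, rfl, by simp⟩
    · refine ⟨1, fun i => if i = 0 then a else b, by simp, by simp, ?_⟩
      intro i hi
      obtain rfl : i = 0 := by omega
      simpa using ⟨hlt, hγ⟩
  · rw [intervalIntegral.integral_congr (g := fun _ => (1 : ℝ)) fun t ht => ?_]
    · simp
    · rw [Set.uIcc_of_le hab] at ht
      exact hspeed t ht

theorem IsUnitSpeedGeodesic.dist_le {x : ℝ → M} {J : Set ℝ} (hx : IsUnitSpeedGeodesic F x J)
    (hF : IsFinsler F) (hJc : J.OrdConnected) {s₁ s₂ : ℝ} (h₁ : s₁ ∈ J) (h₂ : s₂ ∈ J)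
    (h : s₁ ≤ s₂) : dist F (x s₁) (x s₂) ≤ s₂ - s₁ :=
  dist_le_of_unit_speed hF h (hx.smooth.mono (hJc.out h₁ h₂))
    fun t ht => hx.unit_speed t (hJc.out h₁ h₂ ht)

/-- The reversed arc `r ↦ x (-r)` has velocity `-x'`, which has unit length by absolute homogeneity
with factor `-1`. -/
theorem IsUnitSpeedGeodesic.dist_le_reverse {x : ℝ → M} {J : Set ℝ}
    (hx : IsUnitSpeedGeodesic F x J) (hF : IsFinsler F) (habs : IsAbsolutelyHomogeneous F)
    (hJ : IsOpen J) (hJc : J.OrdConnected) {s₁ s₂ : ℝ} (h₁ : s₁ ∈ J) (h₂ : s₂ ∈ J)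
    (h : s₁ ≤ s₂) : dist F (x s₂) (x s₁) ≤ s₂ - s₁ := by
  have hmem : ∀ t ∈ Set.Icc (-s₂) (-s₁), -t ∈ J := fun t ht =>
    hJc.out h₁ h₂ ⟨by linarith [ht.2], by linarith [ht.1]⟩
  have hsmooth : ContMDiffOn 𝓘(ℝ, ℝ) (𝓡 n) ∞ (fun r => x (-r)) (Set.Icc (-s₂) (-s₁)) :=
    hx.smooth.comp (contDiff_neg.contMDiff.contMDiffOn) hmem
  have := dist_le_of_unit_speed hF (neg_le_neg h) hsmooth fun t ht => by
    have hv := hx.unit_speed (-t) (hmem t ht)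
    rw [velocity_comp_neg (hx.mdifferentiableAt hJ (hmem t ht))]
    have h' := habs (x (-t)) (velocity (n := n) x (-t)).snd (-1)
    rw [abs_neg, abs_one, one_mul] at h'
    exact (congrArg (fun w => F ⟨x (-t), w⟩) (neg_one_smul ℝ _)).symm.trans (h'.trans hv)
  simp only [neg_neg] at this
  linarith

theorem ricciAlong_le {c : ℝ} (hF : IsFinsler F) (hRic : RicciLE F c) {x : ℝ → M} {J : Set ℝ}
    (hx : IsUnitSpeedGeodesic F x J) (hJ : IsOpen J) {s : ℝ} (hs : s ∈ J) :
    ricciAlong F x s ≤ -c ^ 2 := by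
  have hspeed := (localExpr_deriv_coordCurve F (hx.mdifferentiableAt hJ hs)).trans
    (hx.unit_speed s hs)
  -- The Ricci bound is available only at nonzero vectors; the velocity is one because `F` vanishes
  -- on zero vectors and equals `1` here.
  have hne : deriv (coordCurve (n := n) x s) s ≠ 0 := by
    intro h0
    have hlin := map_zero (mfderiv 𝓘(ℝ, Coord n) (𝓡 n) (chartAt (Coord n) (x s)).symm
      (chartAt (Coord n) (x s) (x s)))
    have hz : localExpr F (x s) (chartAt (Coord n) (x s) (x s)) 0 = 0 :=
      (congrArg (fun w => F ⟨(chartAt (Coord n) (x s)).symm (chartAt (Coord n) (x s) (x s)), w⟩)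
        hlin).trans (hF.apply_zero _)
    rw [h0, hz] at hspeed
    exact zero_ne_one hspeed
  have h := hRic (x s) _ hne (deriv (coordCurve x s) s)
  rw [hF.quad_metric_localExpr (x s) hne, hspeed, one_pow, mul_one] at h
  exact h

end Finsler

/-! ### The distance comparison. -/

theorem mainTheorem6 {n : ℕ} (hn : 2 ≤ n) {M : Type*} [TopologicalSpace M] [ConnectedSpace M]
    [ChartedSpace (EuclideanSpace ℝ (Fin n)) M] [IsManifold (𝓡 n) ∞ M]
    (F : TangentBundle (𝓡 n) M → ℝ) (hF : Finsler.IsFinsler F)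
    (c : ℝ) (hc : 0 < c) (hRic : Finsler.RicciLE F c)
    (f : ℝ → M) (J : Set ℝ) (x : ℝ → M) (p : ℝ → ℝ)
    (hf : Finsler.IsProjectiveMap F f J x p) :
    (∀ s₁ ∈ J, ∀ s₂ ∈ J, s₁ ≤ s₂ →
      Finsler.poincareDist (p s₁) (p s₂)
        ≥ 2 * c / √((n : ℝ) - 1) * Finsler.dist F (f (p s₁)) (f (p s₂))) ∧
    (Finsler.IsAbsolutelyHomogeneous F →
      ∀ a ∈ Set.Ioo (-1 : ℝ) 1, ∀ b ∈ Set.Ioo (-1 : ℝ) 1,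
        Finsler.poincareDist a b ≥ 2 * c / √((n : ℝ) - 1) * Finsler.dist F (f a) (f b)) := by
  have hn1 : (0 : ℝ) < (n : ℝ) - 1 := by
    have : (2 : ℝ) ≤ n := by exact_mod_cast hn
    linarith
  have hsqrt : 0 < √((n : ℝ) - 1) := Real.sqrt_pos.2 hn1
  -- The factor `2 / (n - 1)` in the projective equation fixes `k² = c² / (n - 1)`.
  have hS : ∀ s ∈ J, Finsler.schwarzian p s ≤ -2 * (c / √((n : ℝ) - 1)) ^ 2 := by
    intro s hs
    rw [hf.schwarzian_eq s hs, div_pow, Real.sq_sqrt hn1.le]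
    have h := mul_le_mul_of_nonneg_left (Finsler.ricciAlong_le hF hRic hf.geodesic hf.isOpen hs)
      (div_pos two_pos hn1).le
    refine h.trans_eq ?_
    ring
  have hP : ∀ s₁ ∈ J, ∀ s₂ ∈ J, s₁ ≤ s₂ →
      2 * c / √((n : ℝ) - 1) * (s₂ - s₁) ≤ Finsler.poincareDist (p s₁) (p s₂) := by
    intro s₁ h₁ s₂ h₂ h
    rw [mul_div_assoc]
    exact Finsler.le_poincareDist hf.isOpen hf.ordConnected hf.smooth hf.deriv_ne_zero hf.image_eq
      hS h₁ h₂ h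
  have hK : 0 ≤ 2 * c / √((n : ℝ) - 1) := by positivity
  have hforward : ∀ s₁ ∈ J, ∀ s₂ ∈ J, s₁ ≤ s₂ → Finsler.poincareDist (p s₁) (p s₂)
        ≥ 2 * c / √((n : ℝ) - 1) * Finsler.dist F (f (p s₁)) (f (p s₂)) := by
    intro s₁ h₁ s₂ h₂ h
    rw [hf.comp_eq s₁ h₁, hf.comp_eq s₂ h₂]
    exact (mul_le_mul_of_nonneg_left (hf.geodesic.dist_le hF hf.ordConnected h₁ h₂ h) hK).trans
      (hP s₁ h₁ s₂ h₂ h)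
  refine ⟨hforward, fun habs a ha b hb => ?_⟩
  rw [← hf.image_eq] at ha hb
  obtain ⟨s₁, h₁, rfl⟩ := ha
  obtain ⟨s₂, h₂, rfl⟩ := hb
  -- The cases follow the order along the geodesic, not that of `a` and `b`, since `p` may decrease.
  rcases le_total s₁ s₂ with h | h
  · exact hforward s₁ h₁ s₂ h₂ h
  · rw [hf.comp_eq s₁ h₁, hf.comp_eq s₂ h₂, Finsler.poincareDist_comm]
    exact (mul_le_mul_of_nonneg_left
      (hf.geodesic.dist_le_reverse hF habs hf.isOpen hf.ordConnected h₂ h₁ h) hK).trans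
      (hP s₂ h₂ s₁ h₁ h)
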